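/- Let $X_1,X_2,\dots$ be i.i.d. standard exponential random variables, $S_i=X_1+\dots+X_i$, and $Y_k=\frac{2}{k(k+1)}\sum_{i=1}^k S_i$. Then $(Y_1,\dots,Y_n)^\top=A_n(X_1,\dots,X_n)^\top$, where $A_n$ is the lower triangular $n\times n$ matrix with entries $(A_n)_{ij}=\frac{2(i-j+1)}{i(i+1)}$ for $j\le i$. Put $L_n=A_n^{-1}$ and let $$p_n(\mathbf y)=|\det L_n|\,\prod_{i=1}^n e^{-(L_n\mathbf y)_i}\,\mathbb I_{\{(L_n\mathbf y)_i\ge 0\}},\qquad \mathbf y\in\mathbb R^n,$$ be the density of $(Y_1,\dots,Y_n)$. For $1\le k\le n$ and $t\in\mathbb R$ define the $k$-th partial density of $\min_{1\le i\le n}Y_i$ by $$g_n^{(k)}(t)=\int_{\{\mathbf y\in\mathbb R^n:\ y_i\ge t\ (1\le i\le n),\ y_k=t\}}p_n(\mathbf y)\,d\lambda_{n-1}(\mathbf y),$$ where $\lambda_{n-1}$ is the $(n-1)$-dimensional Lebesgue measure on the hyperplane $\{y_k=t\}$. Then there are positive constants $c_k$, $k\ge 1$, such that for every $n\ge 2$,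 every $1\le k\le n-1$ and every $t\in\mathbb R$ the integral defining $g_n^{(k)}(t)$ is finite and $$g_n^{(k)}(t)=c_k\,\bigl(te^{-t}\bigr)^{k-1}g_{n-k+1}^{(1)}(t)$$ (with $0^0=1$). Moreover, $c_k=O\bigl(\sqrt k\,e^k\bigr)$ as $k\to\infty$. -/

import Mathlib

open MeasureTheory ProbabilityTheory Matrix

/-- The `n × n` matrix `A_n` taking the increments `(x_1, …, x_n)` of a walk
`s_i = x_1 + ⋯ + x_i` to its normalized areas `y_k = 2 / (k (k + 1)) * (s_1 + ⋯ + s_k)`.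
The one-based index of `i : Fin n` is `i + 1`, so the entry in row `k` and column `j ≤ k`
(one-based) is `2 (k - j + 1) / (k (k + 1))`; see `areaMatrix_mulVec`. -/
noncomputable def areaMatrix (n : ℕ) : Matrix (Fin n) (Fin n) ℝ :=
  Matrix.of fun i j =>
    if j ≤ i then 2 * ((i : ℝ) - (j : ℝ) + 1) / (((i : ℝ) + 1) * ((i : ℝ) + 2)) else 0

/-- The joint density `p(y) = |det A_n⁻¹| p_X(A_n⁻¹ y)` of `Y_n = A_n X_n`, where
`p_X(x) = ∏ i, e^{-x_i} 1_{x_i ≥ 0}` is the density of the vector `X_n` of `n` independent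
standard exponential random variables; see `map_normalizedArea`. -/
noncomputable def areaDensity (n : ℕ) (y : Fin n → ℝ) : ℝ :=
  |((areaMatrix n)⁻¹).det| * ∏ i, exponentialPDFReal 1 (((areaMatrix n)⁻¹ *ᵥ y) i)

/-- The coordinates of a point of the hyperplane `{y ∈ ℝⁿ : y_k = t}` (with `k` one-based) other
than the `k`-th. -/
abbrev SliceCoord (n k : ℕ) : Type := {i : Fin n // (i : ℕ) + 1 ≠ k}

/-- The point of the hyperplane `{y ∈ ℝⁿ : y_k = t}` (with `k` one-based) whose other coordinates
are given by `z`. -/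
def slicePoint (n k : ℕ) (t : ℝ) (z : SliceCoord n k → ℝ) : Fin n → ℝ :=
  fun i => if h : (i : ℕ) + 1 ≠ k then z ⟨i, h⟩ else t

/-- The set `{y : y ≥ t 𝟏, y_k = t}` in the coordinates of the hyperplane `y_k = t`. -/
def sliceSet (n k : ℕ) (t : ℝ) : Set (SliceCoord n k → ℝ) :=
  {z | ∀ i, t ≤ slicePoint n k t z i}

/-- The `k`-th partial density `g_n^{(k)}(t)` (with `1 ≤ k ≤ n`) of `min (Y_1, …, Y_n)`: the
integral of the density of `(Y_1, …, Y_n)` over `{y : y ≥ t 𝟏, y_k = t}` with respect to the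
`(n-1)`-dimensional Lebesgue measure. -/
noncomputable def partialDensity (n k : ℕ) (t : ℝ) : ℝ :=
  ∫ z in sliceSet n k t, areaDensity n (slicePoint n k t z)

/-- The normalized areas of the walk with increments `x`. -/
theorem areaMatrix_mulVec (n : ℕ) (x : Fin n → ℝ) (k : Fin n) :
    (areaMatrix n *ᵥ x) k =
      2 / (((k : ℝ) + 1) * ((k : ℝ) + 2)) * ∑ i ∈ Finset.Iic k, ∑ j ∈ Finset.Iic i, x j := by
  have h1 : ∑ i ∈ Finset.Iic k, ∑ j ∈ Finset.Iic i, x j =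
      ∑ j ∈ Finset.Iic k, ∑ i ∈ Finset.Icc j k, x j := by
    apply Finset.sum_comm'
    intro i j
    simp only [Finset.mem_Iic, Finset.mem_Icc]
    constructor
    · rintro ⟨h, h'⟩
      exact ⟨⟨h', h⟩, h'.trans h⟩
    · rintro ⟨⟨h, h'⟩, _⟩
      exact ⟨h', h⟩
  rw [h1, Finset.mul_sum]
  simp only [Matrix.mulVec, dotProduct, areaMatrix, Matrix.of_apply, ite_mul, zero_mul]
  rw [← Finset.sum_filter]
  have h2 : (Finset.univ.filter fun j => j ≤ k) = Finset.Iic k := by ext; simp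
  rw [h2]
  refine Finset.sum_congr rfl fun j hj => ?_
  have hjk : (j : ℕ) ≤ (k : ℕ) := by simpa using hj
  rw [Finset.sum_const, Fin.card_Icc, nsmul_eq_mul, Nat.cast_sub (by omega)]
  push_cast
  ring

theorem areaMatrix_det_ne_zero (n : ℕ) : (areaMatrix n).det ≠ 0 := by
  have h : (areaMatrix n).IsLowerTriangular := by
    intro i j hij
    have : ¬ j ≤ i := not_le.mpr (by simpa using hij)
    simp [areaMatrix, this]
  rw [Matrix.det_of_isLowerTriangular _ h]
  refine Finset.prod_ne_zero_iff.mpr fun i _ => ?_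
  simp only [areaMatrix, Matrix.of_apply, le_refl, if_true, sub_self]
  positivity

theorem lintegral_fin_prod (n : ℕ) (f : Fin n → ℝ → ENNReal) (hf : ∀ i, Measurable (f i)) :
    ∫⁻ x : Fin n → ℝ, ∏ i, f i (x i) = ∏ i, ∫⁻ a, f i a := by
  induction n with
  | zero => simp [volume_pi]
  | succ n ih =>
    have e := (volume_preserving_piFinSuccAbove (fun _ : Fin (n + 1) => ℝ) 0).symm
    rw [← e.lintegral_comp (by fun_prop)]
    simp only [Fin.prod_univ_succ]
    rw [← ih (fun i => f i.succ) fun i => hf _, Measure.volume_eq_prod,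
      ← lintegral_prod_mul (hf 0).aemeasurable (Finset.measurable_fun_prod _
        fun i _ => (hf i.succ).comp (measurable_pi_apply i)).aemeasurable]
    rfl

theorem pi_expMeasure (n : ℕ) :
    Measure.pi (fun _ : Fin n => expMeasure 1) =
      volume.withDensity fun x : Fin n → ℝ => ∏ i, exponentialPDF 1 (x i) := by
  have hm : Measurable (exponentialPDF 1) := (measurable_exponentialPDFReal 1).ennreal_ofReal
  have := isProbabilityMeasure_expMeasure one_pos
  refine Measure.pi_eq fun s hs => ?_
  rw [withDensity_apply _ (MeasurableSet.univ_pi hs),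
    ← lintegral_indicator (MeasurableSet.univ_pi hs)]
  have h1 : (Set.univ.pi s).indicator (fun x : Fin n → ℝ => ∏ i, exponentialPDF 1 (x i)) =
      fun x => ∏ i, (s i).indicator (exponentialPDF 1) (x i) := by
    ext x
    by_cases hx : x ∈ Set.univ.pi s
    · rw [Set.indicator_of_mem hx]
      exact Finset.prod_congr rfl fun i _ => (Set.indicator_of_mem (hx i (Set.mem_univ i)) _).symm
    · rw [Set.indicator_of_notMem hx]
      obtain ⟨i, hi⟩ : ∃ i, x i ∉ s i := by simpa [Set.mem_univ_pi] using hx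
      exact (Finset.prod_eq_zero (Finset.mem_univ i) (Set.indicator_of_notMem hi _)).symm
  rw [h1, lintegral_fin_prod n (fun i => (s i).indicator (exponentialPDF 1))
    fun i => hm.indicator (hs i)]
  refine Finset.prod_congr rfl fun i _ => ?_
  rw [lintegral_indicator (hs i), expMeasure, gammaMeasure, withDensity_apply _ (hs i)]
  rfl

/-- `areaDensity n` is the density of the law of `(Y_1, …, Y_n)`. -/
theorem map_normalizedArea {Ω : Type*} [MeasurableSpace Ω] (P : Measure Ω)
    [IsProbabilityMeasure P] (n : ℕ) (X : Fin n → Ω → ℝ) (hX : ∀ i, Measurable (X i))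
    (hlaw : ∀ i, P.map (X i) = expMeasure 1) (hind : iIndepFun X P) :
    P.map (fun ω => areaMatrix n *ᵥ fun i => X i ω) =
      volume.withDensity fun y => ENNReal.ofReal (areaDensity n y) := by
  have hm : Measurable (exponentialPDF 1) := (measurable_exponentialPDFReal 1).ennreal_ofReal
  have hA : Measurable fun x : Fin n → ℝ => areaMatrix n *ᵥ x :=
    (Matrix.toLin' (areaMatrix n)).continuous_of_finiteDimensional.measurable
  have hL : Measurable fun x : Fin n → ℝ => (areaMatrix n)⁻¹ *ᵥ x :=
    (Matrix.toLin' (areaMatrix n)⁻¹).continuous_of_finiteDimensional.measurable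
  have hXm : Measurable fun ω i => X i ω := measurable_pi_lambda _ hX
  have hlawX : P.map (fun ω i => X i ω) = Measure.pi fun _ : Fin n => expMeasure 1 := by
    rw [(iIndepFun_iff_map_fun_eq_pi_map fun i => (hX i).aemeasurable).mp hind]
    simp only [hlaw]
  have hdet := areaMatrix_det_ne_zero n
  have hvol := Real.map_matrix_volume_pi_eq_smul_volume_pi hdet
  have hp : (fun y => ENNReal.ofReal (areaDensity n y)) = fun y =>
      ENNReal.ofReal |(areaMatrix n).det⁻¹| *
        ∏ i, exponentialPDF 1 (((areaMatrix n)⁻¹ *ᵥ y) i) := by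
    ext y
    rw [areaDensity, ENNReal.ofReal_mul (abs_nonneg _),
      ENNReal.ofReal_prod_of_nonneg fun i _ => exponentialPDFReal_nonneg one_pos _,
      Matrix.det_nonsing_inv, Ring.inverse_eq_inv']
    rfl
  have hF : Measurable fun y : Fin n → ℝ =>
      ∏ i, exponentialPDF 1 (((areaMatrix n)⁻¹ *ᵥ y) i) := by fun_prop
  have h1 : P.map (fun ω => areaMatrix n *ᵥ fun i => X i ω) =
      (P.map fun ω i => X i ω).map fun x => areaMatrix n *ᵥ x :=
    (Measure.map_map hA hXm).symm
  rw [h1, hlawX, pi_expMeasure]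
  ext s hs
  rw [Measure.map_apply hA hs, withDensity_apply _ (hA hs), withDensity_apply _ hs, hp,
    lintegral_const_mul _ hF, ← smul_eq_mul, ← lintegral_smul_measure, ← Measure.restrict_smul,
    ← hvol, setLIntegral_map hs hF (by exact hA)]
  refine lintegral_congr fun x => ?_
  rw [Matrix.toLin'_apply, Matrix.mulVec_mulVec,
    Matrix.nonsing_inv_mul _ (isUnit_iff_ne_zero.mpr hdet), Matrix.one_mulVec]

/-! Since i(i+1)/2 · y_i is the accumulated area S_1 + ⋯ + S_i, the inverse matrix L_n takes second
differences of accumulated areas (`areaMatrix_inv_mulVec`). Put W_i = i(i+1)/2 · (y_i - t).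
Triangular numbers have second difference 1, so (L_n y)_i is t plus a second difference of W. The
density is therefore supported where these second differences are at least -t, and there, by
telescoping, it is a constant times e^{-nt} e^{-(W_n - W_{n-1})} (`areaDensity_add_mul`).

On the slice, W ≥ 0 and W_k = 0. This zero cuts W into a = k - 1 values before it and b = n - k
after it. The only second difference that sees both blocks is centred at the zero; it is a sum of
nonnegative terms, so for t ≥ 0 its constraint is void. Hence the domain is a product
(`glue_admissible_iff`), and as b ≥ 1 the exponential depends on the last block alone. The integral
is k(k+1)/2 · e^{-nt} times the volume of the first region times an integral depending only on b and
t (`lintegral_slice`). That volume is homogeneous of degree a in t, and the case a = 0 gives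
g_{n-k+1}^{(1)}; comparing the two yields the identity with c_k = k(k+1)/2 times the volume at t =
1. For t < 0 both sides vanish.

For the growth, the second-difference map with zero boundary values has determinant ±(a+1) and sends
the region into a translated simplex, so the volume at t = 1 is at most a^a / ((a+1) · a!).
Stirling's formula finishes. -/

/-! ### Padded sequences and second differences -/

/-- The sequence `0, 0, f 0, …, f (n - 1), 0, 0, …`. -/
noncomputable def padded (n : ℕ) : (Fin n → ℝ) →ₗ[ℝ] (ℕ → ℝ) where
  toFun f j := if h : 2 ≤ j ∧ j < n + 2 then f ⟨j - 2, by omega⟩ else 0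
  map_add' f g := by
    ext j
    by_cases h : 2 ≤ j ∧ j < n + 2 <;> simp [h]
  map_smul' c f := by
    ext j
    by_cases h : 2 ≤ j ∧ j < n + 2 <;> simp [h]

theorem padded_apply (n : ℕ) (f : Fin n → ℝ) (j : ℕ) :
    padded n f j = if h : 2 ≤ j ∧ j < n + 2 then f ⟨j - 2, by omega⟩ else 0 := rfl

@[simp]
theorem padded_zero (n : ℕ) (f : Fin n → ℝ) : padded n f 0 = 0 := by
  simp [padded_apply]

@[simp]
theorem padded_one (n : ℕ) (f : Fin n → ℝ) : padded n f 1 = 0 := by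
  simp [padded_apply]

theorem padded_of_lt {n : ℕ} (f : Fin n → ℝ) {i : ℕ} (hi : i < n) :
    padded n f (i + 2) = f ⟨i, hi⟩ := by
  simp [padded_apply, hi]

theorem padded_of_le {n : ℕ} (f : Fin n → ℝ) {i : ℕ} (hi : n ≤ i) :
    padded n f (i + 2) = 0 := by
  simp [padded_apply, hi]

theorem padded_nonneg {n : ℕ} {f : Fin n → ℝ} (hf : ∀ i, 0 ≤ f i) (j : ℕ) :
    0 ≤ padded n f j := by
  rw [padded_apply]
  split_ifs with h
  exacts [hf _, le_rfl]

theorem padded_le {n : ℕ} {f : Fin n → ℝ} {C : ℝ} (hC : 0 ≤ C) (hf : ∀ i, f i ≤ C) (j : ℕ) :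
    padded n f j ≤ C := by
  rw [padded_apply]
  split_ifs with h
  exacts [hf _, hC]

@[fun_prop]
theorem continuous_padded (n j : ℕ) : Continuous fun f : Fin n → ℝ => padded n f j := by
  simp only [padded_apply]
  split_ifs with h
  exacts [continuous_apply _, continuous_const]

/-- The second difference `f (j + 2) - 2 f (j + 1) + f j`. -/
def secondDiff : (ℕ → ℝ) →ₗ[ℝ] (ℕ → ℝ) where
  toFun f j := f (j + 2) - 2 * f (j + 1) + f j
  map_add' f g := by
    ext j
    simp only [Pi.add_apply]
    ring
  map_smul' c f := by
    ext j
    simp only [Pi.smul_apply, smul_eq_mul, RingHom.id_apply]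
    ring

theorem secondDiff_apply (f : ℕ → ℝ) (j : ℕ) :
    secondDiff f j = f (j + 2) - 2 * f (j + 1) + f j := rfl

theorem sum_secondDiff (f : ℕ → ℝ) (n : ℕ) :
    ∑ j ∈ Finset.range n, secondDiff f j = f (n + 1) - f n - (f 1 - f 0) := by
  induction n with
  | zero => simp
  | succ n ih =>
    rw [Finset.sum_range_succ, ih, secondDiff_apply]
    ring

theorem sum_mul_secondDiff (f : ℕ → ℝ) (n : ℕ) :
    ∑ j ∈ Finset.range n, ((j : ℝ) + 1) * secondDiff f (j + 1) =
      n * f (n + 2) - (n + 1) * f (n + 1) + f 1 := by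
  induction n with
  | zero => simp
  | succ n ih =>
    rw [Finset.sum_range_succ, ih, secondDiff_apply]
    push_cast
    ring

theorem continuous_secondDiff_padded (n j : ℕ) :
    Continuous fun f : Fin n → ℝ => secondDiff (padded n f) j := by
  simp only [secondDiff_apply]
  fun_prop

/-- The first `n` second differences of the sequence `0, 0, f 0, …, f (n - 1)`. -/
noncomputable def initialSecondDiff (n : ℕ) : (Fin n → ℝ) →ₗ[ℝ] (Fin n → ℝ) :=
  LinearMap.funLeft ℝ ℝ (fun i : Fin n => (i : ℕ)) ∘ₗ secondDiff ∘ₗ padded n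

theorem initialSecondDiff_apply (n : ℕ) (f : Fin n → ℝ) (i : Fin n) :
    initialSecondDiff n f i = secondDiff (padded n f) i := rfl

theorem initialSecondDiff_injective (n : ℕ) : Function.Injective (initialSecondDiff n) := by
  rw [← LinearMap.ker_eq_bot, LinearMap.ker_eq_bot']
  intro f hf
  have h : ∀ j ≤ n + 1, padded n f j = 0 := by
    intro j
    induction j using Nat.strong_induction_on with
    | _ j ih =>
      intro hj
      match j with
      | 0 => simp
      | 1 => simp
      | j + 2 =>
        have h1 := congrFun hf ⟨j, by omega⟩
        rw [initialSecondDiff_apply, secondDiff_apply] at h1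
        simp only [Pi.zero_apply] at h1
        rw [ih (j + 1) (by omega) (by omega), ih j (by omega) (by omega)] at h1
        linarith
  ext i
  rw [← padded_of_lt f i.2, h _ (by omega)]
  rfl

/-- The second differences of the sequence `0, f 0, …, f (n - 1), 0` around its `n` inner terms. -/
noncomputable def dirichletSecondDiff (n : ℕ) : (Fin n → ℝ) →ₗ[ℝ] (Fin n → ℝ) :=
  LinearMap.funLeft ℝ ℝ (fun i : Fin n => (i : ℕ) + 1) ∘ₗ secondDiff ∘ₗ padded n

theorem dirichletSecondDiff_apply (n : ℕ) (f : Fin n → ℝ) (i : Fin n) :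
    dirichletSecondDiff n f i = secondDiff (padded n f) (i + 1) := rfl

theorem sum_fin_ite_le {n : ℕ} (F : ℕ → ℝ) (i : Fin n) :
    (∑ j : Fin n, if j ≤ i then F j else 0) = ∑ j ∈ Finset.range (i + 1), F j := by
  simp only [Fin.le_def]
  rw [Fin.sum_univ_eq_sum_range (fun j => if j ≤ (i : ℕ) then F j else 0) n, ← Finset.sum_filter]
  refine Finset.sum_congr ?_ fun _ _ => rfl
  ext j
  simp only [Finset.mem_filter, Finset.mem_range]
  omega

theorem abs_det_dirichletSecondDiff (n : ℕ) :
    |LinearMap.det (dirichletSecondDiff n)| = n + 1 := by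
  -- Summation by parts with weights j + 1 turns the tridiagonal map into an upper bidiagonal one,
  -- so both determinants in the factorization are triangular: n! for `N` and ±(n+1)! for `B`.
  let N : Matrix (Fin n) (Fin n) ℝ := Matrix.of fun i j => if j ≤ i then (j : ℝ) + 1 else 0
  let B := Matrix.toLin' N ∘ₗ dirichletSecondDiff n
  have hN : N.det = ∏ i : Fin n, ((i : ℝ) + 1) := by
    have h : N.IsLowerTriangular := by
      intro i j hij
      have : ¬ j ≤ i := not_le.mpr (by simpa using hij)
      simp [N, this]
    rw [Matrix.det_of_isLowerTriangular _ h]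
    simp [N]
  have hBf (f : Fin n → ℝ) (i : Fin n) :
      B f i = ((i : ℝ) + 1) * padded n f (i + 3) - (i + 2) * padded n f (i + 2) := by
    have h1 : B f i = ∑ j : Fin n,
        if j ≤ i then ((j : ℝ) + 1) * secondDiff (padded n f) (j + 1) else 0 := by
      simp [B, N, Matrix.mulVec, dotProduct, dirichletSecondDiff_apply]
    rw [h1, sum_fin_ite_le (fun j => ((j : ℝ) + 1) * secondDiff (padded n f) (j + 1)),
      sum_mul_secondDiff, padded_one, show (i : ℕ) + 1 + 2 = i + 3 by ring,
      show (i : ℕ) + 1 + 1 = i + 2 by ring]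
    push_cast
    ring
  have hB : LinearMap.det B = ∏ i : Fin n, (-((i : ℝ) + 2)) := by
    have hent (i j : Fin n) : LinearMap.toMatrix' B i j =
        ((i : ℝ) + 1) * (if (i : ℕ) + 1 = j then 1 else 0) - (i + 2) * (if i = j then 1 else 0) := by
      rw [LinearMap.toMatrix'_apply, hBf, padded_of_lt _ i.2]
      congr 2
      · by_cases hi : (i : ℕ) + 1 < n
        · rw [show (i : ℕ) + 3 = (i + 1) + 2 by ring, padded_of_lt _ hi]
          simp [Pi.single_apply, Fin.ext_iff]
        · rw [show (i : ℕ) + 3 = (i + 1) + 2 by ring, padded_of_le _ (by omega), if_neg (by omega)]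
      · simp [Pi.single_apply]
    have h : (LinearMap.toMatrix' B).IsUpperTriangular := by
      intro i j hij
      have : j < i := hij
      rw [hent, if_neg (by omega), if_neg (by omega)]
      ring
    rw [← LinearMap.det_toMatrix', Matrix.det_of_isUpperTriangular h]
    refine Finset.prod_congr rfl fun i _ => ?_
    rw [hent]
    simp
  have h1 : LinearMap.det B = N.det * LinearMap.det (dirichletSecondDiff n) := by
    rw [LinearMap.det_comp, LinearMap.det_toLin']
  rw [hB, hN] at h1
  have h2 := congrArg abs h1
  rw [abs_mul, Finset.abs_prod, Finset.abs_prod] at h2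
  have h3 : ∏ i : Fin n, |-((i : ℝ) + 2)| = (n + 1) * ∏ i : Fin n, |(i : ℝ) + 1| := by
    have : ∀ m : ℕ, ∏ i ∈ Finset.range m, |-((i : ℝ) + 2)| =
        (m + 1) * ∏ i ∈ Finset.range m, |(i : ℝ) + 1| := by
      intro m
      induction m with
      | zero => simp
      | succ m ih =>
        rw [Finset.prod_range_succ, Finset.prod_range_succ, ih, abs_neg,
          abs_of_nonneg (by positivity), abs_of_nonneg (by positivity)]
        push_cast
        ring
    rw [Fin.prod_univ_eq_prod_range (fun i => |-((i : ℝ) + 2)|),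
      Fin.prod_univ_eq_prod_range (fun i => |(i : ℝ) + 1|), this]
  have h4 : 0 < ∏ i : Fin n, |(i : ℝ) + 1| :=
    Finset.prod_pos fun i _ => abs_pos.mpr (by positivity)
  rw [h3] at h2
  nlinarith [mul_right_cancel₀ h4.ne' (h2.trans (mul_comm _ _))]

/-! ### Volume of the convexity region and finiteness of the tail integral -/

/-- The convexity region: nonnegative `f` such that the first `m` second differences of the
sequence `0, 0, f 0, …, f (n - 1), 0, …` are at least `-t`. -/
def convexityRegion (n m : ℕ) (t : ℝ) : Set (Fin n → ℝ) :=
  {f | (∀ i, 0 ≤ f i) ∧ ∀ j < m, -t ≤ secondDiff (padded n f) j}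

theorem measurableSet_convexityRegion (n m : ℕ) (t : ℝ) :
    MeasurableSet (convexityRegion n m t) := by
  have h : IsClosed (convexityRegion n m t) := by
    simp only [convexityRegion, Set.ofPred_and, Set.ofPred_forall]
    refine (isClosed_iInter fun i => isClosed_le continuous_const (continuous_apply i)).inter
      (isClosed_iInter fun j => isClosed_iInter fun _ =>
        isClosed_le continuous_const (continuous_secondDiff_padded n j))
  exact h.measurableSet

theorem volume_simplex_le (n : ℕ) {s : ℝ} (hs : 0 ≤ s) :
    volume {x : Fin n → ℝ | (∀ i, 0 ≤ x i) ∧ ∑ i, x i ≤ s} ≤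
      ENNReal.ofReal (s ^ n / n.factorial) := by
  induction n generalizing s with
  | zero =>
    refine (measure_mono (Set.subset_univ _)).trans ?_
    simp [volume_pi]
  | succ n ih =>
    have e := (volume_preserving_piFinSuccAbove (fun _ : Fin (n + 1) => ℝ) 0).symm
    have hm : MeasurableSet {x : Fin (n + 1) → ℝ | (∀ i, 0 ≤ x i) ∧ ∑ i, x i ≤ s} := by
      simp only [Set.ofPred_and, Set.ofPred_forall]
      exact (MeasurableSet.iInter fun i => measurableSet_le (by fun_prop) (by fun_prop)).inter
        (measurableSet_le (by fun_prop) (by fun_prop))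
    rw [← e.measure_preimage hm.nullMeasurableSet, Measure.volume_eq_prod,
      Measure.prod_apply (e.measurable hm)]
    have h1 (a : ℝ) : volume (Prod.mk a ⁻¹' ((MeasurableEquiv.piFinSuccAbove
        (fun _ : Fin (n + 1) => ℝ) 0).symm ⁻¹'
          {x : Fin (n + 1) → ℝ | (∀ i, 0 ≤ x i) ∧ ∑ i, x i ≤ s})) ≤
        (Set.Icc 0 s).indicator (fun a => ENNReal.ofReal ((s - a) ^ n / n.factorial)) a := by
      have h2 : (Prod.mk a ⁻¹' ((MeasurableEquiv.piFinSuccAbove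
        (fun _ : Fin (n + 1) => ℝ) 0).symm ⁻¹'
          {x : Fin (n + 1) → ℝ | (∀ i, 0 ≤ x i) ∧ ∑ i, x i ≤ s})) =
          {x : Fin n → ℝ | (0 ≤ a ∧ ∀ i, 0 ≤ x i) ∧ a + ∑ i, x i ≤ s} := by
        ext x
        simp [MeasurableEquiv.piFinSuccAbove, Fin.forall_fin_succ, Fin.sum_univ_succ]
      rw [h2]
      by_cases ha : a ∈ Set.Icc 0 s
      · rw [Set.indicator_of_mem ha]
        refine (measure_mono ?_).trans (ih (s := s - a) (by linarith [ha.2]))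
        rintro x ⟨⟨_, hx⟩, hx'⟩
        exact ⟨hx, by linarith⟩
      · rw [Set.indicator_of_notMem ha]
        refine (measure_mono (t := ∅) ?_).trans (by simp)
        rintro x ⟨⟨h0, hx⟩, hx'⟩
        exact ha ⟨h0, by linarith [Finset.sum_nonneg fun i (_ : i ∈ Finset.univ) => hx i]⟩
    refine (lintegral_mono h1).trans ?_
    rw [lintegral_indicator measurableSet_Icc, ← ofReal_integral_eq_lintegral_ofReal]
    · apply ENNReal.ofReal_le_ofReal
      rw [integral_Icc_eq_integral_Ioc, ← intervalIntegral.integral_of_le hs,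
        intervalIntegral.integral_div,
        intervalIntegral.integral_comp_sub_left (fun x => x ^ n) s, integral_pow]
      simp [Nat.factorial_succ]
      field_simp
      rfl
    · exact (Continuous.continuousOn (by fun_prop)).integrableOn_compact isCompact_Icc
    · refine (ae_restrict_iff' measurableSet_Icc).mpr (Filter.Eventually.of_forall fun a ha => ?_)
      have : 0 ≤ s - a := by linarith [ha.2]
      simp only [Pi.zero_apply]
      positivity

/-- After adding t, the Dirichlet second differences are nonnegative. Unshifted, they sum to -(f 0 +
f (n - 1)) ≤ 0 when n ≥ 1, so the image lies in a translate of the simplex of size n t; dividing by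
the determinant n + 1 gives the bound. -/
theorem volume_convexityRegion_le (n : ℕ) {t : ℝ} (ht : 0 ≤ t) :
    volume (convexityRegion n (n + 1) t) ≤
      ENNReal.ofReal ((n * t) ^ n / n.factorial / (n + 1)) := by
  have h1 : dirichletSecondDiff n '' convexityRegion n (n + 1) t ⊆
      (fun x => (fun _ => t) + x) ⁻¹' {x : Fin n → ℝ | (∀ i, 0 ≤ x i) ∧ ∑ i, x i ≤ n * t} := by
    rintro _ ⟨f, ⟨hf, hf'⟩, rfl⟩
    refine ⟨fun i => ?_, ?_⟩
    · have := hf' (i + 1) (by omega)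
      change 0 ≤ t + secondDiff (padded n f) (i + 1)
      linarith
    · simp only [Pi.add_apply, Finset.sum_add_distrib, dirichletSecondDiff_apply]
      rw [Fin.sum_univ_eq_sum_range (fun i => secondDiff (padded n f) (i + 1))]
      have h := sum_secondDiff (padded n f) (n + 1)
      rw [Finset.sum_range_succ', secondDiff_apply _ 0, show n + 1 + 1 = n + 2 by ring,
        padded_of_le f le_rfl] at h
      simp at h ⊢
      linarith [padded_nonneg hf (n + 1), padded_nonneg hf 2]
  have h2 := (measure_mono h1).trans_eq (measure_preimage_add volume _ _)
  rw [Measure.addHaar_image_linearMap, abs_det_dirichletSecondDiff] at h2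
  have h3 := h2.trans (volume_simplex_le n (by positivity))
  rw [ENNReal.ofReal_div_of_pos (by positivity), ENNReal.le_div_iff_mul_le, mul_comm]
  · exact h3
  · left
    simp only [ne_eq, ENNReal.ofReal_eq_zero, not_le]
    positivity
  · left
    exact ENNReal.ofReal_ne_top

/-- A second difference of nonnegative terms is at least -2 times its middle term, so the open cube
of side 1/2 lies in the region. -/
theorem volume_convexityRegion_pos (n m : ℕ) : 0 < volume (convexityRegion n m 1) := by
  have h : Set.univ.pi (fun _ : Fin n => Set.Ioo (0 : ℝ) (1 / 2)) ⊆ convexityRegion n m 1 := by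
    intro f hf
    have h0 : ∀ i, 0 ≤ f i := fun i => (hf i trivial).1.le
    refine ⟨h0, fun j _ => ?_⟩
    have := padded_le (by norm_num) (fun i => (hf i trivial).2.le) (j + 1)
    rw [secondDiff_apply]
    linarith [padded_nonneg h0 (j + 2), padded_nonneg h0 j]
  refine lt_of_lt_of_le (IsOpen.measure_pos volume ?_ ?_) (measure_mono h)
  · exact isOpen_set_pi Set.finite_univ fun _ _ => isOpen_Ioo
  · exact Set.univ_pi_nonempty_iff.mpr fun _ => ⟨1 / 4, by norm_num, by norm_num⟩

open scoped Pointwise in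
theorem convexityRegion_smul (n m : ℕ) {t : ℝ} (ht : 0 < t) :
    convexityRegion n m t = t • convexityRegion n m 1 := by
  ext f
  rw [Set.mem_smul_set_iff_inv_smul_mem₀ ht.ne']
  simp only [convexityRegion, Set.mem_ofPred_eq, map_smul, Pi.smul_apply, smul_eq_mul]
  have h1 (x : ℝ) : 0 ≤ t⁻¹ * x ↔ 0 ≤ x := by
    rw [mul_nonneg_iff_of_pos_left (inv_pos.mpr ht)]
  have h2 (x : ℝ) : -1 ≤ t⁻¹ * x ↔ -t ≤ x := by
    rw [inv_mul_eq_div, le_div_iff₀ ht, neg_one_mul]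
  simp only [h1, h2]

theorem volume_convexityRegion (n : ℕ) {t : ℝ} (ht : 0 ≤ t) :
    volume (convexityRegion n (n + 1) t) =
      ENNReal.ofReal (t ^ n) * volume (convexityRegion n (n + 1) 1) := by
  -- Scaling needs t > 0. At t = 0 the region is null if n > 0 and the one-point space if n = 0, in
  -- agreement with 0^0 = 1.
  rcases ht.eq_or_lt with rfl | ht
  · rcases Nat.eq_zero_or_pos n with rfl | hn
    · have (t : ℝ) (ht : 0 ≤ t) : convexityRegion 0 (0 + 1) t = Set.univ := by
        ext f
        simp [convexityRegion, secondDiff_apply, padded_apply, ht]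
      simp [this]
    · have := volume_convexityRegion_le n le_rfl
      simp [hn.ne'] at this
      simp [this, hn.ne']
  · rw [convexityRegion_smul _ _ ht, Measure.addHaar_smul_of_nonneg _ ht.le]
    simp

/-- With the n initial second differences as coordinates, the exponent telescopes to minus their
sum. Dropping the constraint w ≥ 0 leaves a product of integrals of e^{-x} over x ≥ -t. -/
theorem lintegral_convexityRegion_exp_lt_top (n : ℕ) (t : ℝ) :
    ∫⁻ w in convexityRegion n n t,
      ENNReal.ofReal (Real.exp (-(padded n w (n + 1) - padded n w n))) < ⊤ := by
  let h : ℝ → ENNReal := (Set.Ici (-t)).indicator fun x => ENNReal.ofReal (Real.exp (-x))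
  have hm : Measurable h := Measurable.indicator (by fun_prop) measurableSet_Ici
  have hh : ∫⁻ x, h x < ⊤ := by
    have : IntegrableOn (fun x : ℝ => Real.exp (-x)) (Set.Ici (-t)) := by
      rw [integrableOn_Ici_iff_integrableOn_Ioi]
      exact integrableOn_exp_neg_Ioi (-t)
    rw [lintegral_indicator measurableSet_Ici]
    exact this.lintegral_lt_top
  have hdet : LinearMap.det (initialSecondDiff n) ≠ 0 := fun h0 =>
    (LinearMap.bot_lt_ker_of_det_eq_zero h0).ne'
      (LinearMap.ker_eq_bot.mpr (initialSecondDiff_injective n))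
  have hF : Measurable fun x : Fin n → ℝ => ∏ i, h (x i) :=
    Finset.measurable_fun_prod _ fun i _ => hm.comp (measurable_pi_apply i)
  have hD : Measurable (initialSecondDiff n) :=
    (initialSecondDiff n).continuous_of_finiteDimensional.measurable
  calc _ = ∫⁻ w in convexityRegion n n t, ∏ i, h (initialSecondDiff n w i) := by
        refine setLIntegral_congr_fun (measurableSet_convexityRegion n n t) fun w hw => ?_
        have h1 (i : Fin n) : h (initialSecondDiff n w i) =
            ENNReal.ofReal (Real.exp (-secondDiff (padded n w) i)) :=
          Set.indicator_of_mem (s := Set.Ici (-t)) (hw.2 i i.2) _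
        simp only [h1]
        rw [← ENNReal.ofReal_prod_of_nonneg fun i _ => (Real.exp_pos _).le, ← Real.exp_sum,
          Finset.sum_neg_distrib, Fin.sum_univ_eq_sum_range (fun i => secondDiff (padded n w) i),
          sum_secondDiff]
        simp
    _ ≤ ∫⁻ w, ∏ i, h (initialSecondDiff n w i) := setLIntegral_le_lintegral _ _
    _ = ENNReal.ofReal |(LinearMap.det (initialSecondDiff n))⁻¹| * ∏ _i : Fin n, ∫⁻ x, h x := by
        rw [← lintegral_fin_prod n (fun _ => h) fun _ => hm, ← smul_eq_mul,
          ← lintegral_smul_measure, ← Measure.map_linearMap_addHaar_eq_smul_addHaar volume hdet,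
          lintegral_map hF hD]
    _ < ⊤ := ENNReal.mul_lt_top ENNReal.ofReal_lt_top (ENNReal.prod_lt_top fun _ _ => hh)

/-! ### The density in terms of second differences -/

theorem sum_Iic_fin {n : ℕ} (F : ℕ → ℝ) (i : Fin n) :
    ∑ j ∈ Finset.Iic i, F j = ∑ j ∈ Finset.range (i + 1), F j := by
  rw [← sum_fin_ite_le, ← Finset.sum_filter]
  refine Finset.sum_congr ?_ fun _ _ => rfl
  ext j
  simp

theorem areaMatrix_inv_mulVec (n : ℕ) (y : Fin n → ℝ) (i : Fin n) :
    ((areaMatrix n)⁻¹ *ᵥ y) i =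
      secondDiff (padded n fun j => ((j : ℝ) + 1) * (j + 2) / 2 * y j) i := by
  set E := padded n fun j => ((j : ℝ) + 1) * (j + 2) / 2 * y j with hE
  have h : areaMatrix n *ᵥ (fun i : Fin n => secondDiff E i) = y := by
    ext k
    have h1 (i : Fin n) : ∑ j ∈ Finset.Iic i, secondDiff E j = E (i + 2) - E (i + 1) := by
      rw [sum_Iic_fin, sum_secondDiff]
      simp [hE]
    rw [areaMatrix_mulVec]
    simp only [h1]
    rw [sum_Iic_fin (fun i => E (i + 2) - E (i + 1)),
      Finset.sum_range_sub (fun i => E (i + 1)), hE, padded_one,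
      show (k : ℕ) + 1 + 1 = k + 2 by ring, padded_of_lt _ k.2]
    field_simp
    simp
  rw [← h, Matrix.mulVec_mulVec,
    Matrix.nonsing_inv_mul _ (isUnit_iff_ne_zero.mpr (areaMatrix_det_ne_zero n)),
    Matrix.one_mulVec]

theorem abs_det_areaMatrix_inv (n : ℕ) :
    |((areaMatrix n)⁻¹).det| = ∏ i : Fin n, ((i : ℝ) + 1) * (i + 2) / 2 := by
  have h : (areaMatrix n).IsLowerTriangular := by
    intro i j hij
    have : ¬ j ≤ i := not_le.mpr (by simpa using hij)
    simp [areaMatrix, this]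
  rw [Matrix.det_nonsing_inv, Ring.inverse_eq_inv', Matrix.det_of_isLowerTriangular _ h,
    ← Finset.prod_inv_distrib, Finset.abs_prod]
  refine Finset.prod_congr rfl fun i _ => ?_
  simp only [areaMatrix, Matrix.of_apply, le_refl, if_true, sub_self, zero_add, mul_one, inv_div]
  exact abs_of_nonneg (by positivity)

theorem exponentialPDFReal_one (x : ℝ) :
    exponentialPDFReal 1 x = if 0 ≤ x then Real.exp (-x) else 0 := by
  simp [exponentialPDFReal, gammaPDFReal]

theorem prod_exponentialPDFReal_one {n : ℕ} (x : Fin n → ℝ) :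
    ∏ i, exponentialPDFReal 1 (x i) = if ∀ i, 0 ≤ x i then Real.exp (-∑ i, x i) else 0 := by
  simp only [exponentialPDFReal_one]
  split_ifs with h
  · rw [← Finset.sum_neg_distrib, Real.exp_sum]
    exact Finset.prod_congr rfl fun i _ => if_pos (h i)
  · push Not at h
    obtain ⟨i, hi⟩ := h
    exact Finset.prod_eq_zero (Finset.mem_univ i) (if_neg (not_le.mpr hi))

theorem areaDensity_nonneg (n : ℕ) (y : Fin n → ℝ) : 0 ≤ areaDensity n y :=
  mul_nonneg (abs_nonneg _) (Finset.prod_nonneg fun _ _ => exponentialPDFReal_nonneg one_pos _)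

theorem measurable_areaDensity (n : ℕ) : Measurable (areaDensity n) := by
  have hL : Measurable fun x : Fin n → ℝ => (areaMatrix n)⁻¹ *ᵥ x :=
    (Matrix.toLin' (areaMatrix n)⁻¹).continuous_of_finiteDimensional.measurable
  exact (Finset.measurable_fun_prod _ fun i _ => (measurable_exponentialPDFReal 1).comp
    ((measurable_pi_apply i).comp hL)).const_mul _

/-- Nonnegative increments have nonnegative areas, so a negative coordinate lies outside the
support. -/
theorem areaDensity_eq_zero_of_neg {n : ℕ} {y : Fin n → ℝ} {k : Fin n} (hk : y k < 0) :
    areaDensity n y = 0 := by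
  rw [areaDensity, prod_exponentialPDFReal_one, if_neg, mul_zero]
  intro h
  have h1 : areaMatrix n *ᵥ ((areaMatrix n)⁻¹ *ᵥ y) = y := by
    rw [Matrix.mulVec_mulVec,
      Matrix.mul_nonsing_inv _ (isUnit_iff_ne_zero.mpr (areaMatrix_det_ne_zero n)),
      Matrix.one_mulVec]
  rw [← h1, areaMatrix_mulVec] at hk
  refine hk.not_ge (mul_nonneg (by positivity) (Finset.sum_nonneg fun i _ =>
    Finset.sum_nonneg fun j _ => h j))

theorem secondDiff_padded_triangular {n i : ℕ} (hi : i < n) :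
    secondDiff (padded n fun j => ((j : ℝ) + 1) * (j + 2) / 2) i = 1 := by
  have h (j : ℕ) (hj : j < n + 2) :
      padded n (fun j => ((j : ℝ) + 1) * (j + 2) / 2) j = (j : ℝ) * (j - 1) / 2 := by
    match j with
    | 0 => simp
    | 1 => simp
    | j + 2 =>
      rw [padded_of_lt _ (by omega)]
      push_cast
      ring
  rw [secondDiff_apply, h _ (by omega), h _ (by omega), h _ (by omega)]
  push_cast
  ring

/-- The density in the coordinates `W_i = i (i + 1) / 2 * (y_i - t)`. -/
theorem areaDensity_add_mul (n : ℕ) (t : ℝ) (W : Fin n → ℝ) :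
    areaDensity n (fun i => t + 2 / (((i : ℝ) + 1) * (i + 2)) * W i) =
      (∏ i : Fin n, ((i : ℝ) + 1) * (i + 2) / 2) *
        if ∀ i < n, -t ≤ secondDiff (padded n W) i then
          Real.exp (-(n * t)) * Real.exp (-(padded n W (n + 1) - padded n W n)) else 0 := by
  have hx (i : Fin n) :
      ((areaMatrix n)⁻¹ *ᵥ (fun i => t + 2 / (((i : ℝ) + 1) * (i + 2)) * W i)) i =
        t + secondDiff (padded n W) i := by
    have hf : (fun j : Fin n => ((j : ℝ) + 1) * (j + 2) / 2 *
        (t + 2 / (((j : ℝ) + 1) * (j + 2)) * W j)) =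
        t • (fun j : Fin n => ((j : ℝ) + 1) * (j + 2) / 2) + W := by
      ext j
      simp only [Pi.add_apply, Pi.smul_apply, smul_eq_mul]
      field_simp
    rw [areaMatrix_inv_mulVec, hf, map_add, map_add, map_smul, map_smul, Pi.add_apply,
      Pi.smul_apply, secondDiff_padded_triangular i.2, smul_eq_mul, mul_one]
  rw [areaDensity, abs_det_areaMatrix_inv, prod_exponentialPDFReal_one]
  congr 1
  simp only [hx]
  have hiff : (∀ i : Fin n, 0 ≤ t + secondDiff (padded n W) i) ↔
      ∀ i < n, -t ≤ secondDiff (padded n W) i :=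
    ⟨fun h i hi => by linarith [h ⟨i, hi⟩], fun h i => by linarith [h i i.2]⟩
  simp only [hiff]
  refine if_congr Iff.rfl ?_ rfl
  rw [← Real.exp_add, Finset.sum_add_distrib,
    Fin.sum_univ_eq_sum_range (fun i => secondDiff (padded n W) i), sum_secondDiff]
  simp
  ring

theorem lintegral_eq_lintegral_comp_mul {ι : Type*} [Fintype ι] {D : ι → ℝ} (hD : ∀ i, 0 < D i)
    {F : (ι → ℝ) → ENNReal} (hF : Measurable F) :
    ∫⁻ z, F z = ENNReal.ofReal (∏ i, D i) * ∫⁻ z : ι → ℝ, F fun i => D i * z i := by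
  classical
  have hpos : 0 < ∏ i, D i := Finset.prod_pos fun i _ => hD i
  have h := Real.smul_map_diagonal_volume_pi (D := D) (by rw [det_diagonal]; exact hpos.ne')
  rw [det_diagonal, abs_of_pos hpos] at h
  conv_lhs => rw [← h]
  rw [lintegral_smul_measure, lintegral_map hF
    (Matrix.toLin' (diagonal D)).continuous_of_finiteDimensional.measurable, smul_eq_mul]
  congr 1
  refine lintegral_congr fun z => congrArg F ?_
  ext i
  simp [mulVec_diagonal]

/-! ### Splitting at the zero -/

/-- The sequence `u 0, …, u (a - 1), 0, w 0, …, w (b - 1)`. -/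
noncomputable def glue (a b : ℕ) (p : (Fin a → ℝ) × (Fin b → ℝ)) (i : Fin (a + 1 + b)) : ℝ :=
  if (i : ℕ) ≤ a then padded a p.1 (i + 2) else padded b p.2 (i - a + 1)

theorem padded_glue_left {a b j : ℕ} (p : (Fin a → ℝ) × (Fin b → ℝ)) (hj : j ≤ a + 2) :
    padded (a + 1 + b) (glue a b p) j = padded a p.1 j := by
  match j with
  | 0 => simp
  | 1 => simp
  | j + 2 => rw [padded_of_lt _ (by omega), glue, if_pos (show j ≤ a by omega)]

/-- Position a + 2 of the padded sequence, the separating zero, plays the role of the second leading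
zero of the last block. The first leading zero has no counterpart, hence 1 ≤ j. -/
theorem padded_glue_right {a b j : ℕ} (p : (Fin a → ℝ) × (Fin b → ℝ)) (hj : 1 ≤ j)
    (hj' : j ≤ b + 1) :
    padded (a + 1 + b) (glue a b p) (a + 1 + j) = padded b p.2 j := by
  match j with
  | 1 =>
    rw [padded_glue_left p (by omega), padded_of_le _ le_rfl, padded_one]
  | j + 2 =>
    rw [show a + 1 + (j + 2) = (a + 1 + j) + 2 by ring, padded_of_lt _ (by omega), glue,
      if_neg (by simp; omega), show a + 1 + j - a + 1 = j + 2 by omega]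

theorem glue_nonneg_iff {a b : ℕ} (p : (Fin a → ℝ) × (Fin b → ℝ)) :
    (∀ i, 0 ≤ glue a b p i) ↔ (∀ i, 0 ≤ p.1 i) ∧ ∀ i, 0 ≤ p.2 i := by
  constructor
  · intro h
    have h' := padded_nonneg h
    refine ⟨fun i => ?_, fun i => ?_⟩
    · rw [← padded_of_lt p.1 i.2, ← padded_glue_left p (by omega)]
      exact h' _
    · rw [← padded_of_lt p.2 i.2, ← padded_glue_right (a := a) p (by omega) (by omega)]
      exact h' _
  · rintro ⟨h1, h2⟩ i
    rw [glue]
    split_ifs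
    exacts [padded_nonneg h1 _, padded_nonneg h2 _]

theorem glue_admissible_iff {a b : ℕ} (p : (Fin a → ℝ) × (Fin b → ℝ)) {t : ℝ} (ht : 0 ≤ t) :
    ((∀ i, 0 ≤ glue a b p i) ∧
        ∀ i < a + 1 + b, -t ≤ secondDiff (padded (a + 1 + b) (glue a b p)) i) ↔
      p.1 ∈ convexityRegion a (a + 1) t ∧ p.2 ∈ convexityRegion b b t := by
  have hleft (i : ℕ) (hi : i < a + 1) : secondDiff (padded (a + 1 + b) (glue a b p)) i =
      secondDiff (padded a p.1) i := by
    simp only [secondDiff_apply]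
    rw [padded_glue_left p (by omega), padded_glue_left p (by omega),
      padded_glue_left p (by omega)]
  have hright (j : ℕ) (hj : 1 ≤ j) (hj' : j < b) :
      secondDiff (padded (a + 1 + b) (glue a b p)) (a + 1 + j) = secondDiff (padded b p.2) j := by
    simp only [secondDiff_apply]
    rw [add_assoc (a + 1) j, add_assoc (a + 1) j, padded_glue_right p (by omega) (by omega),
      padded_glue_right p (by omega) (by omega), padded_glue_right p (by omega) (by omega)]
  rw [glue_nonneg_iff]
  constructor
  · rintro ⟨⟨h1, h2⟩, h⟩
    refine ⟨⟨h1, fun i hi => ?_⟩, ⟨h2, fun j hj => ?_⟩⟩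
    · rw [← hleft i hi]
      exact h i (by omega)
    -- The initial second difference of the last block alone is its first entry, nonnegative without
    -- any constraint from the glued sequence.
    · rcases Nat.eq_zero_or_pos j with rfl | hj0
      · rw [secondDiff_apply, zero_add, zero_add, padded_one, padded_zero]
        linarith [padded_nonneg h2 2]
      · rw [← hright j hj0 hj]
        exact h _ (by omega)
  · rintro ⟨⟨h1, h1'⟩, ⟨h2, h2'⟩⟩
    refine ⟨⟨h1, h2⟩, fun i hi => ?_⟩
    rcases lt_or_ge i (a + 1) with hia | hia
    · rw [hleft i hia]
      exact h1' i hia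
    · obtain ⟨j, rfl⟩ := Nat.exists_eq_add_of_le hia
      rcases Nat.eq_zero_or_pos j with rfl | hj0
      -- This is the second difference centred at the separating zero: a sum of two nonnegative
      -- neighbours.
      · have h0 := padded_nonneg ((glue_nonneg_iff p).mpr ⟨h1, h2⟩)
        have h3 : padded (a + 1 + b) (glue a b p) (a + 1 + 0 + 1) = 0 := by
          rw [padded_glue_left p (by omega), padded_of_le _ (by omega)]
        rw [secondDiff_apply, h3]
        linarith [h0 (a + 1 + 0 + 2), h0 (a + 1 + 0)]
      · rw [hright j hj0 (by omega)]
        exact h2' j (by omega)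

/-! ### Integration over the slice -/

/-- The coordinates other than the `(a + 1)`-st are the first `a` and the last `b` ones. -/
def sliceCoordEquiv (a b : ℕ) : Fin a ⊕ Fin b ≃ SliceCoord (a + 1 + b) (a + 1) where
  toFun := Sum.elim (fun i => ⟨⟨i, by omega⟩, by simp only; omega⟩)
    (fun j => ⟨⟨a + 1 + j, by omega⟩, by simp only; omega⟩)
  invFun s := if h : (s.1 : ℕ) < a then Sum.inl ⟨s.1, h⟩ else
    Sum.inr ⟨s.1 - (a + 1), by have := s.2; omega⟩
  left_inv s := by
    rcases s with i | j
    · simp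
    · have : ¬ a + 1 + (j : ℕ) < a := by omega
      simp [this]
  right_inv s := by
    obtain ⟨i, hi⟩ := s
    by_cases h : (i : ℕ) < a
    · simp [h]
    · simp only [h, dite_false, Sum.elim_inr]
      ext
      simp only
      omega

theorem lintegral_sliceCoord (a b : ℕ) (F : (SliceCoord (a + 1 + b) (a + 1) → ℝ) → ENNReal) :
    ∫⁻ z, F z = ∫⁻ p : (Fin a → ℝ) × (Fin b → ℝ), F fun s => glue a b p s.1 := by
  let e := (MeasurableEquiv.sumPiEquivProdPi fun _ : Fin a ⊕ Fin b => ℝ).symm.trans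
    (MeasurableEquiv.piCongrLeft (fun _ => ℝ) (sliceCoordEquiv a b))
  have he : MeasurePreserving e volume volume :=
    (volume_measurePreserving_piCongrLeft (fun _ => ℝ) (sliceCoordEquiv a b)).comp
      (volume_measurePreserving_sumPiEquivProdPi_symm fun _ : Fin a ⊕ Fin b => ℝ)
  rw [← he.lintegral_comp_emb e.measurableEmbedding]
  refine lintegral_congr fun p => congrArg F ?_
  ext s
  obtain ⟨s, rfl⟩ := (sliceCoordEquiv a b).surjective s
  rcases s with i | j
  · have h1 : e p (sliceCoordEquiv a b (Sum.inl i)) = p.1 i :=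
      Equiv.piCongrLeft_sumInl (fun _ => ℝ) (sliceCoordEquiv a b) p.1 p.2 i
    rw [h1, ← padded_of_lt p.1 i.2]
    exact (if_pos i.2.le).symm
  · have h1 : e p (sliceCoordEquiv a b (Sum.inr j)) = p.2 j :=
      Equiv.piCongrLeft_sumInr (fun _ => ℝ) (sliceCoordEquiv a b) p.1 p.2 j
    have h2 : ¬ a + 1 + (j : ℕ) ≤ a := by omega
    rw [h1, ← padded_of_lt p.2 j.2]
    change _ = if a + 1 + (j : ℕ) ≤ a then _ else padded b p.2 (a + 1 + j - a + 1)
    rw [if_neg h2, show a + 1 + (j : ℕ) - a + 1 = j + 2 by omega]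

theorem prod_sliceCoord (a b : ℕ) (F : ℕ → ℝ) :
    ∏ i : Fin (a + 1 + b), F i =
      F a * ∏ s : SliceCoord (a + 1 + b) (a + 1), F s.1 := by
  rw [← Finset.mul_prod_erase Finset.univ _ (Finset.mem_univ (⟨a, by omega⟩ : Fin (a + 1 + b)))]
  congr 1
  refine Finset.prod_subtype _ (fun i => ?_) fun i : Fin (a + 1 + b) => F i
  simp [Fin.ext_iff]

theorem measurable_slicePoint (n k : ℕ) (t : ℝ) : Measurable (slicePoint n k t) := by
  refine measurable_pi_lambda _ fun i => ?_
  simp only [slicePoint]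
  split_ifs
  exacts [measurable_pi_apply _, measurable_const]

theorem measurableSet_sliceSet (n k : ℕ) (t : ℝ) : MeasurableSet (sliceSet n k t) := by
  simp only [sliceSet, Set.ofPred_forall]
  exact MeasurableSet.iInter fun i => measurableSet_le measurable_const
    ((measurable_pi_apply i).comp (measurable_slicePoint n k t))

theorem slicePoint_glue {a b : ℕ} (t : ℝ) (p : (Fin a → ℝ) × (Fin b → ℝ)) :
    (slicePoint (a + 1 + b) (a + 1) t fun s =>
        t + 2 / (((s.1 : ℝ) + 1) * (s.1 + 2)) * glue a b p s.1) =
      fun i : Fin (a + 1 + b) => t + 2 / (((i : ℝ) + 1) * (i + 2)) * glue a b p i := by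
  ext i
  simp only [slicePoint]
  split_ifs with h
  · rfl
  · have hi : (i : ℕ) = a := by omega
    rw [glue, if_pos hi.le, padded_of_le _ hi.ge]
    simp

theorem lintegral_slice (a : ℕ) {b : ℕ} (hb : 1 ≤ b) {t : ℝ} (ht : 0 ≤ t) :
    ∫⁻ z in sliceSet (a + 1 + b) (a + 1) t,
        ENNReal.ofReal (areaDensity (a + 1 + b) (slicePoint (a + 1 + b) (a + 1) t z)) =
      ENNReal.ofReal (((a : ℝ) + 1) * (a + 2) / 2 * Real.exp (-((a + 1 + b : ℕ) * t))) *
        (volume (convexityRegion a (a + 1) t) *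
          ∫⁻ w in convexityRegion b b t,
            ENNReal.ofReal (Real.exp (-(padded b w (b + 1) - padded b w b)))) := by
  set G : (SliceCoord (a + 1 + b) (a + 1) → ℝ) → ENNReal :=
    (sliceSet (a + 1 + b) (a + 1) t).indicator fun z =>
      ENNReal.ofReal (areaDensity (a + 1 + b) (slicePoint (a + 1 + b) (a + 1) t z)) with hGdef
  have hG : Measurable G := ((measurable_areaDensity _).comp
    (measurable_slicePoint _ _ _)).ennreal_ofReal.indicator (measurableSet_sliceSet _ _ _)
  have hpt (p : (Fin a → ℝ) × (Fin b → ℝ)) :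
      G (fun s => t + 2 / (((s.1 : ℝ) + 1) * (s.1 + 2)) * glue a b p s.1) =
        ENNReal.ofReal ((∏ i : Fin (a + 1 + b), ((i : ℝ) + 1) * (i + 2) / 2) *
          Real.exp (-((a + 1 + b : ℕ) * t))) *
        ((convexityRegion a (a + 1) t).indicator 1 p.1 *
          (convexityRegion b b t).indicator (fun w =>
            ENNReal.ofReal (Real.exp (-(padded b w (b + 1) - padded b w b)))) p.2) := by
    have hmem : (fun s : SliceCoord (a + 1 + b) (a + 1) =>
        t + 2 / (((s.1 : ℝ) + 1) * (s.1 + 2)) * glue a b p s.1) ∈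
          sliceSet (a + 1 + b) (a + 1) t ↔ ∀ i, 0 ≤ glue a b p i := by
      change (∀ i, t ≤ slicePoint _ _ t _ i) ↔ _
      rw [slicePoint_glue]
      refine forall_congr' fun i => ?_
      rw [le_add_iff_nonneg_right, mul_nonneg_iff_of_pos_left (by positivity)]
    have hadm := glue_admissible_iff p ht
    by_cases h : p.1 ∈ convexityRegion a (a + 1) t ∧ p.2 ∈ convexityRegion b b t
    · have h' := hadm.mpr h
      rw [Set.indicator_of_mem h.1, Set.indicator_of_mem h.2, hGdef,
        Set.indicator_of_mem (hmem.mpr h'.1), slicePoint_glue, areaDensity_add_mul, if_pos h'.2,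
        add_assoc (a + 1) b 1, padded_glue_right p (by omega) (by omega),
        padded_glue_right p (by omega) (by omega), Pi.one_apply, one_mul, ← mul_assoc,
        ENNReal.ofReal_mul (by positivity)]
    · have h0 : (convexityRegion a (a + 1) t).indicator (1 : (Fin a → ℝ) → ENNReal) p.1 *
          (convexityRegion b b t).indicator (fun w =>
            ENNReal.ofReal (Real.exp (-(padded b w (b + 1) - padded b w b)))) p.2 = 0 := by
        rcases not_and_or.mp h with h1 | h1
        · rw [Set.indicator_of_notMem h1, zero_mul]
        · rw [Set.indicator_of_notMem h1, mul_zero]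
      rw [h0, mul_zero, hGdef]
      rw [← hadm, not_and_or, ← hmem] at h
      rcases h with h | h
      · exact Set.indicator_of_notMem h _
      · refine Set.indicator_apply_eq_zero.mpr fun _ => ?_
        rw [slicePoint_glue, areaDensity_add_mul, if_neg h]
        simp
  have hexp : Measurable fun w : Fin b → ℝ =>
      ENNReal.ofReal (Real.exp (-(padded b w (b + 1) - padded b w b))) :=
    ENNReal.measurable_ofReal.comp (Continuous.measurable (by fun_prop))
  -- Pass from y to W on the hyperplane: translate by t, then rescale each free coordinate.
  rw [← lintegral_indicator (measurableSet_sliceSet _ _ _),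
    ← lintegral_add_left_eq_self G (fun _ => t),
    lintegral_eq_lintegral_comp_mul (F := fun z => G ((fun _ => t) + z))
      (D := fun s => 2 / (((s.1 : ℝ) + 1) * (s.1 + 2))) (fun s => by positivity)
      (hG.comp (measurable_const_add _)), lintegral_sliceCoord]
  refine (congrArg _ (lintegral_congr hpt)).trans ?_
  rw [lintegral_const_mul, Measure.volume_eq_prod, lintegral_prod_mul,
    lintegral_indicator_one (measurableSet_convexityRegion _ _ _),
    lintegral_indicator (measurableSet_convexityRegion _ _ _), ← mul_assoc,
    ← ENNReal.ofReal_mul (by positivity)]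
  · congr 2
    -- The Jacobian of the rescaling runs over the free coordinates only, so it cancels every factor
    -- of |det L_n| except that of the fixed coordinate.
    rw [prod_sliceCoord a b fun i => ((i : ℝ) + 1) * (i + 2) / 2, ← mul_assoc]
    congr 1
    rw [mul_left_comm, ← Finset.prod_mul_distrib, Finset.prod_eq_one, mul_one]
    intro s _
    field_simp
  · exact (measurable_one.indicator (measurableSet_convexityRegion _ _ _)).aemeasurable
  · exact (hexp.indicator (measurableSet_convexityRegion _ _ _)).aemeasurable
  · exact ((measurable_one.indicator (measurableSet_convexityRegion _ _ _)).comp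
      measurable_fst).mul
      ((hexp.indicator (measurableSet_convexityRegion _ _ _)).comp measurable_snd)

/-! ### Factorization of the partial densities -/

theorem partialDensity_eq_toReal (n k : ℕ) (t : ℝ) :
    partialDensity n k t = (∫⁻ z in sliceSet n k t,
      ENNReal.ofReal (areaDensity n (slicePoint n k t z))).toReal := by
  rw [partialDensity, integral_eq_lintegral_of_nonneg_ae]
  · exact Filter.Eventually.of_forall fun z => areaDensity_nonneg _ _
  · exact ((measurable_areaDensity n).comp (measurable_slicePoint n k t)).aestronglyMeasurable

theorem areaDensity_slicePoint_of_neg (a b : ℕ) {t : ℝ} (ht : t < 0)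
    (z : SliceCoord (a + 1 + b) (a + 1) → ℝ) :
    areaDensity (a + 1 + b) (slicePoint (a + 1 + b) (a + 1) t z) = 0 :=
  areaDensity_eq_zero_of_neg (k := ⟨a, by omega⟩) (by simpa [slicePoint] using ht)

theorem integrableOn_slice (a : ℕ) {b : ℕ} (hb : 1 ≤ b) (t : ℝ) :
    IntegrableOn (fun z => areaDensity (a + 1 + b) (slicePoint (a + 1 + b) (a + 1) t z))
      (sliceSet (a + 1 + b) (a + 1) t) := by
  rcases lt_or_ge t 0 with ht | ht
  · simp only [areaDensity_slicePoint_of_neg a b ht]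
    exact integrableOn_zero
  · refine ⟨((measurable_areaDensity _).comp (measurable_slicePoint _ _ _)).aestronglyMeasurable,
      ?_⟩
    rw [hasFiniteIntegral_iff_ofReal (Filter.Eventually.of_forall fun z => areaDensity_nonneg _ _),
      lintegral_slice a hb ht]
    exact ENNReal.mul_lt_top ENNReal.ofReal_lt_top (ENNReal.mul_lt_top
      ((volume_convexityRegion_le a ht).trans_lt ENNReal.ofReal_lt_top)
      (lintegral_convexityRegion_exp_lt_top b t))

theorem partialDensity_eq (a : ℕ) {b : ℕ} (hb : 1 ≤ b) (t : ℝ) :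
    partialDensity (a + 1 + b) (a + 1) t =
      ((a : ℝ) + 1) * (a + 2) / 2 * (volume (convexityRegion a (a + 1) 1)).toReal *
        (t * Real.exp (-t)) ^ a * partialDensity (0 + 1 + b) (0 + 1) t := by
  rcases lt_or_ge t 0 with ht | ht
  · simp only [partialDensity, areaDensity_slicePoint_of_neg _ b ht, integral_zero, mul_zero]
  · have h0 : volume (convexityRegion 0 (0 + 1) t) = 1 := by
      have : convexityRegion 0 (0 + 1) t = Set.univ := by
        ext f
        simp [convexityRegion, secondDiff_apply, padded_apply, ht]
      simp [this, volume_pi]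
    simp only [partialDensity_eq_toReal]
    rw [lintegral_slice a hb ht, lintegral_slice 0 hb ht, h0, volume_convexityRegion a ht]
    simp only [ENNReal.toReal_mul, ENNReal.toReal_one]
    rw [ENNReal.toReal_ofReal (by positivity), ENNReal.toReal_ofReal (by positivity),
      ENNReal.toReal_ofReal (by positivity)]
    have hexp : Real.exp (-((a + 1 + b : ℕ) * t)) =
        Real.exp (-t) ^ a * Real.exp (-((0 + 1 + b : ℕ) * t)) := by
      rw [← Real.exp_nat_mul, ← Real.exp_add]
      congr 1
      push_cast
      ring
    rw [hexp, mul_pow]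
    push_cast
    ring

/-! ### Growth of the constants -/

theorem volume_convexityRegion_toReal_le (n : ℕ) :
    ((n : ℝ) + 1) * (n + 2) / 2 * (volume (convexityRegion n (n + 1) 1)).toReal ≤
      ((n : ℝ) + 2) / 2 * ((n : ℝ) ^ n / n.factorial) := by
  have h := ENNReal.toReal_mono ENNReal.ofReal_ne_top (volume_convexityRegion_le n zero_le_one)
  rw [ENNReal.toReal_ofReal (by positivity), mul_one] at h
  calc _ ≤ ((n : ℝ) + 1) * (n + 2) / 2 * ((n : ℝ) ^ n / n.factorial / (n + 1)) := by gcongr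
    _ = _ := by field_simp

theorem pow_self_div_factorial_le {n : ℕ} (hn : 1 ≤ n) :
    (n : ℝ) ^ n / n.factorial ≤ Real.exp n / √n := by
  have hn' : (0 : ℝ) < n := by exact_mod_cast hn
  have h := Stirling.le_factorial_stirling n
  have h1 : √(n : ℝ) ≤ √(2 * Real.pi * n) :=
    Real.sqrt_le_sqrt (by nlinarith [Real.pi_gt_three])
  rw [div_le_div_iff₀ (by positivity) (by positivity)]
  have h2 : √(n : ℝ) * (n / Real.exp 1) ^ n ≤ n.factorial :=
    (mul_le_mul_of_nonneg_right h1 (by positivity)).trans h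
  rw [div_pow, ← Real.exp_nat_mul, mul_one, mul_div_assoc', div_le_iff₀ (Real.exp_pos _)] at h2
  linarith

theorem add_two_div_two_mul_exp_div_sqrt_le {n : ℕ} (hn : 1 ≤ n) :
    ((n : ℝ) + 2) / 2 * (Real.exp n / √n) ≤ 2 * (√((n + 1 : ℕ) : ℝ) * Real.exp (n + 1 : ℕ)) := by
  have hn' : (1 : ℝ) ≤ n := by exact_mod_cast hn
  have h0 : 0 < √(n : ℝ) := by positivity
  have h1 : √(n : ℝ) ≤ √((n + 1 : ℕ) : ℝ) := Real.sqrt_le_sqrt (by simp)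
  have h2 : Real.exp (n : ℝ) ≤ Real.exp (n + 1 : ℕ) := Real.exp_le_exp.mpr (by simp)
  have h3 : √(n : ℝ) * √(n : ℝ) = n := Real.mul_self_sqrt (by positivity)
  have h4 : ((n : ℝ) + 2) / 2 / √n ≤ 2 * √(n : ℝ) := by
    rw [div_le_iff₀ h0, mul_assoc, h3]
    linarith
  calc ((n : ℝ) + 2) / 2 * (Real.exp n / √n) = ((n : ℝ) + 2) / 2 / √n * Real.exp n := by ring
    _ ≤ 2 * √((n + 1 : ℕ) : ℝ) * Real.exp (n + 1 : ℕ) := by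
        refine mul_le_mul (h4.trans (by linarith)) h2 (Real.exp_pos _).le (by positivity)
    _ = _ := by ring

theorem lemma2 :
    ∃ c : ℕ → ℝ,
      (∀ k : ℕ, 1 ≤ k → 0 < c k) ∧
      (∀ n k : ℕ, 2 ≤ n → 1 ≤ k → k ≤ n - 1 → ∀ t : ℝ,
        IntegrableOn (fun z => areaDensity n (slicePoint n k t z)) (sliceSet n k t) ∧
        partialDensity n k t =
          c k * (t * Real.exp (-t)) ^ (k - 1) * partialDensity (n - k + 1) 1 t) ∧
      c =O[Filter.atTop] fun k : ℕ => Real.sqrt k * Real.exp k := by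
  refine ⟨fun k => (((k - 1 : ℕ) : ℝ) + 1) * ((k - 1 : ℕ) + 2) / 2 *
    (volume (convexityRegion (k - 1) (k - 1 + 1) 1)).toReal, fun k _ => ?_, ?_, ?_⟩
  · have h1 := volume_convexityRegion_pos (k - 1) (k - 1 + 1)
    have h2 := (volume_convexityRegion_le (k - 1) zero_le_one).trans_lt ENNReal.ofReal_lt_top
    have := ENNReal.toReal_pos h1.ne' h2.ne
    positivity
  · intro n k hn hk hkn t
    obtain ⟨a, rfl⟩ : ∃ a, k = a + 1 := ⟨k - 1, by omega⟩
    obtain ⟨b, rfl⟩ : ∃ b, n = a + 1 + b := ⟨n - (a + 1), by omega⟩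
    have hb : 1 ≤ b := by omega
    refine ⟨integrableOn_slice a hb t, ?_⟩
    rw [show a + 1 + b - (a + 1) + 1 = 0 + 1 + b by omega]
    exact partialDensity_eq a hb t
  · refine Asymptotics.IsBigO.of_bound 2 ?_
    -- k ≥ 2 makes a = k - 1 ≥ 1, as the Stirling bound divides by √a.
    filter_upwards [Filter.eventually_ge_atTop 2] with k hk
    obtain ⟨a, rfl⟩ : ∃ a, k = a + 1 := ⟨k - 1, by omega⟩
    rw [Real.norm_of_nonneg (by positivity), Real.norm_of_nonneg (by positivity)]
    refine (volume_convexityRegion_toReal_le a).trans ?_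
    refine (mul_le_mul_of_nonneg_left (pow_self_div_factorial_le (by omega))
      (by positivity)).trans (add_two_div_two_mul_exp_div_sqrt_le (by omega))
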